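/- In the sum classic network creation game, the players are $V=\{1,\dots,n\}$ and each link has price $\alpha>0$. A strategy of player $u$ is a set $s_u\subseteq V\setminus\{u\}$. A strategy profile $s=(s_u)_{u\in V}$ yields the undirected graph $G[s]$ on $V$ in which $uv$ is an edge iff $v\in s_u$ or $u\in s_v$, and the cost of player $u$ is $c_u(s)=\alpha|s_u|+\sum_{v\neq u}d_{G[s]}(u,v)$, where vertices in different components have distance $\infty$. The profile $s$ is a Nash equilibrium if no player can decrease her cost by changing only her own strategy, and a graph $G$ is an NE graph (for $\alpha$) if $G=G[s]$ for some Nash equilibrium $s$. A biconnected graph is a connected graph without cut vertices, and a non-trivial biconnected component of $G$ is a maximal biconnected subgraph of $G$ that has at least three vertices. Proposition. Let $\alpha>0$ with $\frac{n-1}{2}\le\alpha<4n$, let $G$ be an NE graph on $n$ vertices that is not a tree, and let $H$ be any non-trivial biconnected component of $G$. Then $$\mathrm{diam}(G)<\mathrm{diam}(H)+994 .$$ -/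

import Mathlib

open scoped ENNReal

namespace NetworkCreation

/-- A strategy of the player `u`: the finite set of nodes other than `u` towards which `u` pays for
a link. -/
abbrev Strategy {V : Type*} (u : V) : Type _ := {t : Finset V // u ∉ t}

/-- A strategy profile: one strategy for each player. -/
abbrev Profile (V : Type*) : Type _ := (u : V) → Strategy u

/-- The communication network of a strategy profile: `u` and `v` are joined by an undirected edge
if one of them pays for a link to the other. -/
def network {V : Type*} (s : Profile V) : SimpleGraph V where
  Adj u v := v ∈ (s u).1 ∨ u ∈ (s v).1
  symm := ⟨fun _ _ h => h.symm⟩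
  loopless := ⟨fun u h => (s u).2 (h.elim id id)⟩

/-- The cost of the player `u`: link price `α` times the number of links bought, plus the sum of
the distances to all other players. Nodes in different components are at distance `∞`. -/
noncomputable def cost {V : Type*} [Fintype V] [DecidableEq V] (α : ℝ) (s : Profile V) (u : V) :
    ℝ≥0∞ :=
  ENNReal.ofReal α * ((s u).1.card : ℝ≥0∞) +
    ∑ v ∈ Finset.univ.erase u, ((network s).edist u v : ℝ≥0∞)

/-- A (pure) Nash equilibrium: no player can strictly lower her own cost by changing only her own
strategy. -/
def IsNashEquilibrium {V : Type*} [Fintype V] [DecidableEq V] (α : ℝ) (s : Profile V) : Prop :=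
  ∀ (u : V) (t : Strategy u), cost α s u ≤ cost α (Function.update s u t) u

/-- `G` is an NE graph for the link price `α` if it is the network of some Nash equilibrium. -/
def IsNEGraph {V : Type*} [Fintype V] [DecidableEq V] (α : ℝ) (G : SimpleGraph V) : Prop :=
  ∃ s : Profile V, IsNashEquilibrium α s ∧ network s = G

/-- A cut vertex: its removal increases the number of connected components. -/
def IsCutVertex {V : Type*} (G : SimpleGraph V) (v : V) : Prop :=
  ENat.card G.ConnectedComponent < ENat.card (G.induce {v}ᶜ).ConnectedComponent

/-- A biconnected graph: a connected graph without cut vertices. -/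
def IsBiconnected {V : Type*} (G : SimpleGraph V) : Prop :=
  G.Connected ∧ ∀ v, ¬ IsCutVertex G v

/-- A biconnected component of `G`: a subgraph that is maximal among the biconnected ones. -/
def IsBiconnectedComponent {V : Type*} (G : SimpleGraph V) (H : G.Subgraph) : Prop :=
  Maximal (fun K : G.Subgraph => IsBiconnected K.coe) H

/-- A non-trivial biconnected component: one with at least three distinct nodes. -/
def IsNontrivialBiconnectedComponent {V : Type*} (G : SimpleGraph V) (H : G.Subgraph) : Prop :=
  IsBiconnectedComponent G H ∧ 3 ≤ H.verts.encard

end NetworkCreation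

/-! ### Biconnected subgraphs through walks avoiding a vertex. -/

namespace NetworkCreation

open SimpleGraph

/-! Every node is within 496 of the block `X` (`dist_le_of_nearest`); two such detours cost 992.
Suppose `z` is farther away, with nearest block node `v`, and let `B` be the nodes hanging on the
block elsewhere than at `v`. All traffic between `B` and the rest passes through `v`. A link from
`z` to `v` would save at least 496 per node of `B`, so `B` is a small fraction of all nodes. A node
of `B` farther than 5 from `v` would then gain by linking to `v`, so `B` lies within 5 of `v`. Hence
deleting a block link that its owner does not need in order to reach `v` lengthens only distances to
the few nodes of `B`, and only by a constant, while `α` is saved: no such link exists. But a block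
node farthest from `v` has two block links, and one of them is of this kind. -/

lemma not_isCutVertex_iff {W : Type*} {K : SimpleGraph W} (hK : K.Connected) (w : W) :
    ¬ IsCutVertex K w ↔ (K.induce {w}ᶜ).Preconnected := by
  have h1 : ENat.card K.ConnectedComponent = 1 := by
    have := hK.preconnected.subsingleton_connectedComponent
    have := hK.nonempty
    have : Nonempty K.ConnectedComponent := this.map K.connectedComponentMk
    exact le_antisymm ((ENat.card_le_one_iff_subsingleton _).2 inferInstance)
      (Order.one_le_iff_pos.2 (by simp [pos_iff_ne_zero]))
  rw [IsCutVertex, h1, not_lt, ENat.card_le_one_iff_subsingleton]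
  exact ⟨fun h a b => ConnectedComponent.exact (Subsingleton.elim _ _),
    fun h => h.subsingleton_connectedComponent⟩

variable {V : Type*} {G : SimpleGraph V}

lemma exists_walk_avoiding_of_reachable_induce {K : G.Subgraph} {w : K.verts}
    {a b : ({w}ᶜ : Set K.verts)} (q : (K.coe.induce {w}ᶜ).Walk a b) :
    ∃ p : G.Walk (a : K.verts) (b : K.verts), p.toSubgraph ≤ K ∧ (w : V) ∉ p.support := by
  induction q with
  | @nil x =>
    refine ⟨.nil, by simp, ?_⟩
    have := x.2
    simp only [Walk.support_nil, List.mem_singleton]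
    intro h
    exact this (Subtype.ext h.symm)
  | @cons x y z h q ih =>
    obtain ⟨p, hp, hw⟩ := ih
    have hadj : K.Adj (x : K.verts) (y : K.verts) := h
    refine ⟨.cons hadj.adj_sub p, ?_, ?_⟩
    · simp only [Walk.toSubgraph, sup_le_iff]
      exact ⟨subgraphOfAdj_le_of_adj K hadj, hp⟩
    · simp only [Walk.support_cons, List.mem_cons, not_or]
      exact ⟨fun h' => x.2 (Subtype.ext h'.symm), hw⟩

lemma reachable_induce_of_walk_avoiding {K : G.Subgraph} {w : K.verts} {a b : V}
    (p : G.Walk a b) (hp : p.toSubgraph ≤ K) (hw : (w : V) ∉ p.support) :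
    ∀ (ha : a ∈ K.verts) (hb : b ∈ K.verts) (haw : (⟨a, ha⟩ : K.verts) ∈ ({w}ᶜ : Set K.verts))
      (hbw : (⟨b, hb⟩ : K.verts) ∈ ({w}ᶜ : Set K.verts)),
      (K.coe.induce {w}ᶜ).Reachable ⟨⟨a, ha⟩, haw⟩ ⟨⟨b, hb⟩, hbw⟩ := by
  induction p with
  | nil => intro _ _ _ _; rfl
  | @cons x y z h q ih =>
    intro ha hb haw hbw
    simp only [Walk.toSubgraph, sup_le_iff] at hp
    simp only [Walk.support_cons, List.mem_cons, not_or] at hw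
    have hxy : K.Adj x y := hp.1.2 (by simp)
    have hyw : (⟨y, hxy.snd_mem⟩ : K.verts) ∈ ({w}ᶜ : Set K.verts) := fun h' =>
      hw.2 (by rw [← show y = (w : V) from congrArg Subtype.val h']; exact q.start_mem_support)
    refine Reachable.trans (Adj.reachable ?_) (ih hp.2 hw.2 hxy.snd_mem hb hyw hbw)
    exact hxy

lemma isBiconnected_coe_iff {K : G.Subgraph} :
    IsBiconnected K.coe ↔ K.Connected ∧ ∀ w ∈ K.verts, ∀ a ∈ K.verts, ∀ b ∈ K.verts,
      a ≠ w → b ≠ w → ∃ p : G.Walk a b, p.toSubgraph ≤ K ∧ w ∉ p.support := by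
  constructor
  · rintro ⟨hc, hcut⟩
    refine ⟨⟨hc⟩, fun w hw a ha b hb haw hbw => ?_⟩
    obtain ⟨q⟩ := (not_isCutVertex_iff hc ⟨w, hw⟩).1 (hcut _)
      ⟨⟨a, ha⟩, fun h => haw (congrArg Subtype.val h)⟩
      ⟨⟨b, hb⟩, fun h => hbw (congrArg Subtype.val h)⟩
    exact exists_walk_avoiding_of_reachable_induce q
  · rintro ⟨hc, h⟩
    refine ⟨hc.coe, fun w => (not_isCutVertex_iff hc.coe w).2 ?_⟩
    rintro ⟨⟨a, ha⟩, haw⟩ ⟨⟨b, hb⟩, hbw⟩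
    obtain ⟨p, hp, hw⟩ := h w w.2 a ha b hb (fun h => haw (Subtype.ext h))
      (fun h => hbw (Subtype.ext h))
    exact reachable_induce_of_walk_avoiding p hp hw ha hb haw hbw

/-- Adding an ear to a biconnected subgraph keeps it biconnected. -/
lemma isBiconnected_sup_path {K : G.Subgraph} (hK : IsBiconnected K.coe) {a b : V}
    (ha : a ∈ K.verts) (hb : b ∈ K.verts) (p : G.Walk a b) (hp : p.IsPath) :
    IsBiconnected (K ⊔ p.toSubgraph).coe := by
  classical
  rw [isBiconnected_coe_iff] at hK ⊢
  obtain ⟨hc, h⟩ := hK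
  refine ⟨Subgraph.connected_sup hc.preconnected p.toSubgraph_connected.preconnected
    ⟨a, ha, p.start_mem_verts_toSubgraph⟩, fun w hw => ?_⟩
  have hcore : ∀ x ∈ K.verts, ∀ y ∈ K.verts, x ≠ w → y ≠ w →
      ∃ q : G.Walk x y, q.toSubgraph ≤ K ⊔ p.toSubgraph ∧ w ∉ q.support := by
    intro x hx y hy hxw hyw
    by_cases hwK : w ∈ K.verts
    · obtain ⟨q, hq, hqw⟩ := h w hwK x hx y hy hxw hyw
      exact ⟨q, hq.trans le_sup_left, hqw⟩
    · obtain ⟨q, hq⟩ := (Subgraph.connected_iff_forall_exists_walk_subgraph K).1 hc |>.2 hx hy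
      exact ⟨q, hq.trans le_sup_left, fun hw' => hwK (hq.1 ((q.mem_verts_toSubgraph).2 hw'))⟩
  have hto : ∀ x ∈ (K ⊔ p.toSubgraph).verts, x ≠ w → ∃ y ∈ K.verts, y ≠ w ∧
      ∃ q : G.Walk x y, q.toSubgraph ≤ K ⊔ p.toSubgraph ∧ w ∉ q.support := by
    intro x hx hxw
    by_cases hxK : x ∈ K.verts
    · exact ⟨x, hxK, hxw, hcore x hxK x hxK hxw hxw⟩
    have hxp : x ∈ p.support := (p.mem_verts_toSubgraph).1 (hx.resolve_left hxK)
    obtain ⟨q, r, rfl⟩ := Walk.mem_support_iff_exists_append.1 hxp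
    rw [Walk.toSubgraph_append] at *
    -- On a path, `w` lies on at most one side of `x`, so `x` can escape into `K` along the other
    -- side.
    by_cases hwq : w ∈ q.support
    · have hwr : w ∉ r.support := by
        intro hwr
        have hnd := hp.support_nodup
        rw [Walk.support_append] at hnd
        have := List.disjoint_of_nodup_append hnd hwq
        rw [← Walk.cons_tail_support, List.mem_cons] at hwr
        exact this (hwr.resolve_left hxw.symm)
      exact ⟨b, hb, fun hh => hwr (hh ▸ r.end_mem_support), r,
        le_sup_right.trans le_sup_right, hwr⟩
    · exact ⟨a, ha, fun hh => hwq (hh ▸ q.start_mem_support), q.reverse,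
        by rw [Walk.toSubgraph_reverse]; exact le_sup_left.trans le_sup_right, by simpa using hwq⟩
  intro x hx y hy hxw hyw
  obtain ⟨x', hx', hxw', q₁, h₁, h₁'⟩ := hto x hx hxw
  obtain ⟨y', hy', hyw', q₂, h₂, h₂'⟩ := hto y hy hyw
  obtain ⟨q, hq, hq'⟩ := hcore x' hx' y' hy' hxw' hyw'
  refine ⟨(q₁.append q).append q₂.reverse, ?_, ?_⟩
  · simp only [Walk.toSubgraph_append, Walk.toSubgraph_reverse, sup_le_iff]
    exact ⟨⟨h₁, hq⟩, h₂⟩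
  · simp only [Walk.mem_support_append_iff, Walk.support_reverse, List.mem_reverse]
    tauto

/-- By maximality, an ear attached to a block already lies in it. -/
lemma IsBiconnectedComponent.support_subset {K : G.Subgraph} (hK : IsBiconnectedComponent G K)
    {a b : V} (ha : a ∈ K.verts) (hb : b ∈ K.verts) (p : G.Walk a b)
    (hp : p.IsPath) {x : V} (hx : x ∈ p.support) : x ∈ K.verts := by
  have := hK.2 (isBiconnected_sup_path hK.1 ha hb p hp) le_sup_left
  exact this.1 (Or.inr ((p.mem_verts_toSubgraph).2 hx))

lemma edist_le_ediam_coe (K : G.Subgraph) {a b : V} (ha : a ∈ K.verts) (hb : b ∈ K.verts) :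
    G.edist a b ≤ K.coe.ediam := by
  refine le_trans ?_ (edist_le_ediam (G := K.coe) (u := ⟨a, ha⟩) (v := ⟨b, hb⟩))
  by_cases h : K.coe.Reachable ⟨a, ha⟩ ⟨b, hb⟩
  · obtain ⟨q, hq⟩ := h.exists_walk_length_eq_edist
    rw [← hq, ← Walk.length_map K.hom q]
    exact edist_le _
  · rw [edist_eq_top_of_not_reachable h]; exact le_top

end NetworkCreation

/-! ### Single-link deviations in an equilibrium. -/

namespace NetworkCreation

open SimpleGraph

section Deviations

variable {V : Type*} [Fintype V] [DecidableEq V] {α : ℝ} {s : Profile V}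

lemma cost_le (hα : 0 ≤ α) (s : Profile V) (u : V) (f : V → ℕ) (k : ℕ) (hk : (s u).1.card ≤ k)
    (hf : ∀ t, (network s).edist u t ≤ f t) :
    cost α s u ≤ ENNReal.ofReal (α * k + ∑ t, (f t : ℝ)) := by
  rw [ENNReal.ofReal_add (by positivity) (by positivity), ENNReal.ofReal_mul hα, cost,
    ENNReal.ofReal_natCast, ENNReal.ofReal_sum_of_nonneg (fun _ _ => by positivity)]
  gcongr
  refine (Finset.sum_le_sum fun t _ => ?_).trans
    (Finset.sum_le_sum_of_subset (Finset.erase_subset u _))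
  rw [ENNReal.ofReal_natCast]
  exact_mod_cast hf t

lemma cost_eq (hα : 0 ≤ α) (hs : (network s).Connected) (u : V) :
    cost α s u =
      ENNReal.ofReal (α * (s u).1.card + ∑ t, ((network s).dist u t : ℝ)) := by
  rw [ENNReal.ofReal_add (by positivity) (by positivity), ENNReal.ofReal_mul hα, cost,
    ENNReal.ofReal_natCast, ENNReal.ofReal_sum_of_nonneg (fun _ _ => by positivity)]
  congr 1
  rw [← Finset.add_sum_erase _ _ (Finset.mem_univ u)]
  simp only [dist_self, CharP.cast_eq_zero, ENNReal.ofReal_zero, zero_add]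
  refine Finset.sum_congr rfl fun t _ => ?_
  rw [ENNReal.ofReal_natCast, ← (hs.preconnected u t).coe_dist_eq_edist]
  simp

/-- Linking to everybody has finite cost, so no player tolerates an infinite distance. -/
lemma IsNashEquilibrium.connected [Nonempty V] (hα : 0 ≤ α) (h : IsNashEquilibrium α s) :
    (network s).Connected := by
  have : (network s).Preconnected := by
    intro u v
    have h1 := (h u ⟨Finset.univ.erase u, by simp⟩).trans
      (cost_le hα _ u (fun _ => 1) _ le_rfl (fun t => ?_))
    · by_contra hr
      have hne : v ≠ u := fun h => hr (h ▸ Reachable.refl _)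
      have h2 : cost α s u = ⊤ := by
        rw [cost, ENNReal.add_eq_top, ENNReal.sum_eq_top]
        refine Or.inr ⟨v, by simp [hne], ?_⟩
        rw [edist_eq_top_of_not_reachable hr]; rfl
      rw [h2] at h1
      simp at h1
    · by_cases ht : u = t
      · subst ht; simp
      · have : (network (Function.update s u ⟨Finset.univ.erase u, by simp⟩)).Adj u t := by
          left; simp [Ne.symm ht]
        exact (edist_le this.toWalk).trans (by simp)
  exact ⟨this⟩

/-- Buying an additional link to `w` does not pay off. -/
lemma IsNashEquilibrium.sum_dist_le_of_buy (hα : 0 ≤ α) (h : IsNashEquilibrium α s)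
    (hs : (network s).Connected) (u w : V) (f : V → ℕ)
    (hf : ∀ t, (network s).dist u t ≤ f t ∨ (network s).dist w t + 1 ≤ f t) :
    ∑ t, ((network s).dist u t : ℝ) ≤ α + ∑ t, (f t : ℝ) := by
  by_cases hw : w = u
  · subst hw
    have : ∑ t, ((network s).dist w t : ℝ) ≤ ∑ t, (f t : ℝ) :=
      Finset.sum_le_sum fun t _ => by have := hf t; norm_cast; omega
    linarith
  have hmem : u ∉ insert w (s u).1 := by simp [Ne.symm hw, (s u).2]
  set s' : Profile V := Function.update s u ⟨insert w (s u).1, hmem⟩ with hs'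
  have hle : network s ≤ network s' := by
    have hsub : ∀ x, (s x).1 ⊆ (s' x).1 := by
      intro x
      by_cases hx : x = u
      · subst hx; simp [hs']
      · simp [hs', hx]
    intro x y hxy
    exact hxy.imp (fun h => hsub _ h) (fun h => hsub _ h)
  have hadj : (network s').Adj u w := Or.inl (by simp [hs'])
  have h1 := (h u ⟨insert w (s u).1, hmem⟩).trans
    (cost_le hα s' u f ((s u).1.card + 1) (by simpa [hs'] using Finset.card_insert_le w (s u).1)
      (fun t => ?_))
  · rw [cost_eq hα hs, ENNReal.ofReal_le_ofReal_iff (by positivity)] at h1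
    push_cast at h1
    linarith
  · rcases hf t with h' | h'
    · refine (edist_anti hle).trans ?_
      rw [← (hs.preconnected u t).coe_dist_eq_edist]
      exact_mod_cast h'
    · obtain ⟨p, hp⟩ := hs.exists_walk_length_eq_dist w t
      refine (edist_le (Walk.cons hadj (p.mapLe hle))).trans ?_
      simp only [Walk.length_cons, Walk.length_map, hp]
      exact_mod_cast h'

/-- Deleting the link to `w` does not pay off. -/
lemma IsNashEquilibrium.le_sum_dist_of_delete (hα : 0 ≤ α) (h : IsNashEquilibrium α s)
    (hs : (network s).Connected) {u w : V} (hw : w ∈ (s u).1) (f : V → ℕ)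
    (hf : ∀ t, ((network s).deleteEdges {s(u, w)}).edist u t ≤ f t) :
    α + ∑ t, ((network s).dist u t : ℝ) ≤ ∑ t, (f t : ℝ) := by
  have hmem : u ∉ (s u).1.erase w := fun h => (s u).2 (Finset.mem_of_mem_erase h)
  set s' : Profile V := Function.update s u ⟨(s u).1.erase w, hmem⟩ with hs'
  have hle : (network s).deleteEdges {s(u, w)} ≤ network s' := by
    have key : ∀ x y, y ∈ (s x).1 → s(x, y) ≠ s(u, w) → y ∈ (s' x).1 := by
      intro x y hy hne
      by_cases hx : x = u
      · subst hx
        simp only [hs', Function.update_self, Finset.mem_erase]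
        exact ⟨fun h => hne (h ▸ rfl), hy⟩
      · simpa [hs', hx] using hy
    intro x y hxy
    rw [deleteEdges_adj] at hxy
    refine hxy.1.imp (fun h => key _ _ h hxy.2) (fun h => key _ _ h ?_)
    rw [Sym2.eq_swap]; exact hxy.2
  have hpos : 1 ≤ (s u).1.card := Finset.card_pos.2 ⟨w, hw⟩
  have h1 := (h u ⟨(s u).1.erase w, hmem⟩).trans
    (cost_le hα s' u f ((s u).1.card - 1) (by simp [hs', Finset.card_erase_of_mem hw])
      (fun t => (edist_anti hle).trans (hf t)))
  rw [cost_eq hα hs, ENNReal.ofReal_le_ofReal_iff (by positivity)] at h1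
  push_cast [hpos] at h1
  linarith

end Deviations

end NetworkCreation

/-! ### Distances across the separating node `v`. -/

namespace NetworkCreation

open SimpleGraph

section Outside

variable {V : Type*} {G : SimpleGraph V}

/-- The nodes that reach a node of `X` other than `v` without passing through `v`. -/
def outside (G : SimpleGraph V) (X : Set V) (v : V) : Set V :=
  {t | ∃ h ∈ X, h ≠ v ∧ ∃ p : G.Walk t h, v ∉ p.support}

lemma mem_outside {X : Set V} {v h : V} (hh : h ∈ X) (hne : h ≠ v) : h ∈ outside G X v :=
  ⟨h, hh, hne, .nil, by simpa using hne.symm⟩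

lemma notMem_outside (X : Set V) (v : V) : v ∉ outside G X v :=
  fun ⟨_, _, _, p, hp⟩ => hp p.start_mem_support

lemma dist_eq_add_of_outside (hG : G.Connected) {X : Set V} {v a t : V} (ha : a ∉ outside G X v)
    (ht : t ∈ outside G X v) : G.dist a t = G.dist a v + G.dist v t := by
  refine le_antisymm hG.dist_triangle ?_
  obtain ⟨p, hp⟩ := hG.exists_walk_length_eq_dist a t
  have hv : v ∈ p.support := by
    by_contra hv
    obtain ⟨h, hh, hne, q, hq⟩ := ht
    exact ha ⟨h, hh, hne, p.append q, by simp [Walk.mem_support_append_iff, hv, hq]⟩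
  obtain ⟨q, r, rfl⟩ := Walk.mem_support_iff_exists_append.1 hv
  rw [← hp, Walk.length_append]
  exact add_le_add (dist_le q) (dist_le r)

/-- A shortest walk from `v` to `a` never enters `outside G X v`, since it would have to return
through `v`; hence it avoids the deleted edge. -/
lemma edist_deleteEdges_le (hG : G.Connected) {X : Set V} {v a u w : V}
    (ha : a ∉ outside G X v) (huw : u ∈ outside G X v ∨ w ∈ outside G X v) :
    (G.deleteEdges {s(u, w)}).edist v a ≤ G.dist v a := by
  obtain ⟨p, hp⟩ := hG.exists_walk_length_eq_dist v a
  have key : ∀ y ∈ p.support, y ∉ outside G X v := by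
    intro y hy hyo
    obtain ⟨q, r, rfl⟩ := Walk.mem_support_iff_exists_append.1 hy
    have h1 := dist_eq_add_of_outside hG ha hyo
    have h2 := dist_le q
    have h3 := dist_le r
    rw [Walk.length_append] at hp
    rw [G.dist_comm (u := a) (v := y), G.dist_comm (u := a) (v := v)] at h1
    have h4 : G.dist v y = 0 := by omega
    rw [hG.dist_eq_zero_iff] at h4
    subst h4
    exact notMem_outside X v hyo
  have he : s(u, w) ∉ p.edges := fun he => huw.elim
    (key u (p.fst_mem_support_of_mem_edges he)) (key w (p.snd_mem_support_of_mem_edges he))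
  rw [← hp, ← Walk.length_transfer p (H := G.deleteEdges {s(u, w)})]
  · exact edist_le _
  · intro e hep
    rw [edgeSet_deleteEdges]
    exact ⟨p.edges_subset_edgeSet hep, fun h => he (h ▸ hep)⟩

/-- The first step of a shortest path from `v` to `z` leaves `X`. If `z` could reach `X` again while
avoiding `v`, this step would lie on a path between two nodes of `X`, hence in `X`. -/
lemma notMem_outside_of_nearest (hG : G.Connected) {X : Set V}
    (hX : ∀ a ∈ X, ∀ b ∈ X, ∀ p : G.Walk a b, p.IsPath → ∀ x ∈ p.support, x ∈ X)
    {v z : V} (hv : v ∈ X) (hmin : ∀ x ∈ X, G.dist v z ≤ G.dist x z) : z ∉ outside G X v := by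
  classical
  rintro ⟨h, hh, hne, q, hq⟩
  obtain ⟨p, hp⟩ := hG.exists_walk_length_eq_dist v z
  have hpath := p.isPath_of_length_eq_dist hp
  cases p with
  | nil => exact hq q.start_mem_support
  | @cons _ y _ hadj r =>
    have hyX : y ∉ X := by
      intro hy
      have h1 := hmin y hy
      have h2 := dist_le r
      rw [Walk.length_cons] at hp
      omega
    have hvr := ((Walk.cons_isPath_iff hadj r).1 hpath).2
    have hv' : v ∉ ((r.append q).bypass).support := fun h' => by
      have := Walk.support_bypass_subset_support _ h'
      rw [Walk.mem_support_append_iff] at this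
      tauto
    refine hyX (hX v hv h hh (.cons hadj (r.append q).bypass) ?_ y (by simp))
    exact (Walk.cons_isPath_iff _ _).2 ⟨Walk.bypass_isPath _, hv'⟩

/-- Keep the part of the walk after its last use of the deleted edge; it starts at `u` or `w`, or is
the whole walk. -/
lemma edist_deleteEdges_le_of_walk {u w a x : V} (p : G.Walk a x) :
    (G.deleteEdges {s(u, w)}).edist a x ≤ p.length ∨
    (G.deleteEdges {s(u, w)}).edist u x ≤ p.length ∨
    (G.deleteEdges {s(u, w)}).edist w x ≤ p.length := by
  induction p with
  | nil => left; simp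
  | @cons a y x h q ih =>
    have hle : (q.length : ℕ∞) ≤ (Walk.cons h q).length := by simp
    rcases ih with ih | ih | ih
    · by_cases he : s(a, y) = s(u, w)
      · rcases Sym2.eq_iff.1 he with ⟨-, rfl⟩ | ⟨-, rfl⟩
        · exact .inr (.inr (ih.trans hle))
        · exact .inr (.inl (ih.trans hle))
      · left
        have hadj : (G.deleteEdges {s(u, w)}).Adj a y := by
          rw [deleteEdges_adj]; exact ⟨h, he⟩
        have h1 : (G.deleteEdges {s(u, w)}).edist a y ≤ 1 :=
          (edist_le hadj.toWalk).trans (by simp)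
        refine (SimpleGraph.edist_triangle (v := y)).trans ((add_le_add h1 ih).trans ?_)
        simp [add_comm]
    · exact .inr (.inl (ih.trans hle))
    · exact .inr (.inr (ih.trans hle))

end Outside

/-! ### Closeness of all nodes to the block. -/

section Nash

variable {V : Type*} [Fintype V] [DecidableEq V] {α : ℝ} {s : Profile V}

/-- A link from `u` to `w` would save at least `k` for each node of `T`. -/
lemma IsNashEquilibrium.card_mul_le (hα : 0 ≤ α) (h : IsNashEquilibrium α s)
    (hs : (network s).Connected) (u w : V) (T : Finset V) (k : ℕ)
    (hT : ∀ t ∈ T, (network s).dist w t + 1 + k ≤ (network s).dist u t) :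
    (T.card : ℝ) * k ≤ α := by
  have h1 := h.sum_dist_le_of_buy hα hs u w
    (fun t => (network s).dist u t - if t ∈ T then k else 0) (fun t => by
      by_cases ht : t ∈ T
      · have := hT t ht
        simp only [ht, if_true]; omega
      · simp [ht])
  have h2 : ∀ t, (((network s).dist u t - if t ∈ T then k else 0 : ℕ) : ℝ) =
      (network s).dist u t - if t ∈ T then (k : ℝ) else 0 := by
    intro t
    by_cases ht : t ∈ T
    · have := hT t ht
      simp only [ht, if_true]
      rw [Nat.cast_sub (by omega)]
    · simp [ht]
  simp only [h2, Finset.sum_sub_distrib, Finset.sum_ite_mem, Finset.univ_inter, Finset.sum_const,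
    nsmul_eq_mul] at h1
  linarith

/-- In an equilibrium with `(n - 1) / 2 ≤ α < 4 * n`, every node is close to a given block-like
set `X`. -/
theorem IsNashEquilibrium.dist_le_of_nearest (hα : 0 < α)
    (hlow : ((Fintype.card V : ℝ) - 1) / 2 ≤ α) (hhigh : α < 4 * (Fintype.card V : ℝ))
    (h : IsNashEquilibrium α s) (hs : (network s).Connected) {X : Set V}
    (hXpath : ∀ a ∈ X, ∀ b ∈ X, ∀ p : (network s).Walk a b, p.IsPath →
      ∀ x ∈ p.support, x ∈ X)
    (hXcut : ∀ w ∈ X, ∀ a ∈ X, ∀ b ∈ X, a ≠ w → b ≠ w →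
      ∃ p : (network s).Walk a b, (∀ x ∈ p.support, x ∈ X) ∧ w ∉ p.support)
    (hX3 : 3 ≤ X.encard) {v z : V} (hv : v ∈ X)
    (hmin : ∀ x ∈ X, (network s).dist v z ≤ (network s).dist x z) :
    (network s).dist v z ≤ 496 := by
  classical
  by_contra! hD
  set G := network s with hGdef
  set n := Fintype.card V with hn
  have hz : z ∉ outside G X v := notMem_outside_of_nearest hs hXpath hv hmin
  let B : Finset V := Finset.univ.filter (· ∈ outside G X v)
  have hB : ∀ t, t ∈ B ↔ t ∈ outside G X v := by simp [B]
  have hthird : ∀ a b : V, ∃ c ∈ X, c ≠ a ∧ c ≠ b := by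
    intro a b
    by_contra! hcon
    have hsub : X ⊆ {a, b} := fun c hc => by
      by_cases hca : c = a
      · exact Or.inl hca
      · exact Or.inr (hcon c hc hca)
    have h1 := hX3.trans ((Set.encard_le_encard hsub).trans (Set.encard_insert_le {b} a))
    rw [Set.encard_singleton] at h1
    exact absurd h1 (by decide)
  have hcard3 : 3 ≤ n := by
    have h1 : X.encard ≤ (n : ℕ∞) := by
      rw [hn, ← ENat.card_eq_coe_fintype_card, ← Set.encard_univ]
      exact Set.encard_le_encard (Set.subset_univ X)
    exact_mod_cast hX3.trans h1
  -- The link from `z` to `v` gives `496 * |B| ≤ α < 4n`, and `496 = 4 * 124`.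
  have hsmall : 124 * (B.card : ℝ) < n := by
    have h1 := h.card_mul_le hα.le hs z v B 496 (fun t ht => by
      have := dist_eq_add_of_outside hs hz ((hB t).1 ht)
      rw [G.dist_comm (u := z) (v := v)] at this
      change G.dist v t + 1 + 496 ≤ G.dist z t
      omega)
    push_cast at h1
    linarith
  -- At distance 6 or more, a link to `v` saves 5 for each node off `B`, so `5 * (n - |B|) ≤ α < 4n`
  -- and `|B| > n / 5`.
  have hnear : ∀ t ∈ outside G X v, G.dist v t ≤ 5 := by
    intro t ht
    by_contra! hL
    have h1 := h.card_mul_le hα.le hs t v Bᶜ 5 (fun a ha => by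
      rw [Finset.mem_compl, hB] at ha
      have := dist_eq_add_of_outside hs ha ht
      rw [G.dist_comm (u := t), this, G.dist_comm (u := v) (v := a)]; omega)
    rw [Finset.card_compl, Nat.cast_sub (Finset.card_le_univ _)] at h1
    push_cast at h1
    linarith
  have hnearX : ∀ t ∈ X, G.dist v t ≤ 5 := by
    intro t ht
    by_cases htv : t = v
    · subst htv; simp
    · exact hnear t (mem_outside ht htv)
  -- Off `B`, distances from `u` run through `v` and survive the deletion; on `B` they grow by at
  -- most 21. As `n ≥ 3`, the loss is below `21n / 124 < n / 3 ≤ (n - 1) / 2 ≤ α`.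
  have hdel : ∀ u ∈ X, ∀ w ∈ X, w ∈ (s u).1 →
      ¬ (G.deleteEdges {s(u, w)}).edist u v ≤ G.dist u v := by
    intro u hu w hw hbuy hkeep
    set G' := G.deleteEdges {s(u, w)} with hG'
    have huw : u ≠ w := fun hh => (s u).2 (hh ▸ hbuy)
    have hout : u ∈ outside G X v ∨ w ∈ outside G X v := by
      by_cases huv : u = v
      · exact Or.inr (mem_outside hw (huv ▸ huw.symm))
      · exact Or.inl (mem_outside hu huv)
    have huv5 : G'.edist u v ≤ 5 := by
      refine hkeep.trans ?_
      rw [G.dist_comm]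
      exact_mod_cast hnearX u hu
    have htwo : ∀ x, G.dist v x ≤ 5 → G'.edist u x ≤ 10 ∨ G'.edist w x ≤ 5 := by
      intro x hx
      obtain ⟨p, hp⟩ := hs.exists_walk_length_eq_dist v x
      have hp5 : (p.length : ℕ∞) ≤ 5 := by rw [hp]; exact_mod_cast hx
      rcases edist_deleteEdges_le_of_walk (u := u) (w := w) p with h1 | h1 | h1
      · left
        exact (SimpleGraph.edist_triangle (v := v)).trans
          ((add_le_add huv5 (h1.trans hp5)).trans (by norm_num))
      · exact Or.inl ((h1.trans hp5).trans (by norm_num))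
      · exact Or.inr (h1.trans hp5)
    -- Some walk in `X` joins `u` to `w` without the edge `uw`. Where it first leaves the 10-ball of
    -- `u`, `htwo` puts the next node within 5 of `w`: in total `10 + 1 + 5`.
    have hcyc : G'.edist u w ≤ 16 := by
      by_contra hfar
      obtain ⟨c, hc, hcu, hcw⟩ := hthird u w
      obtain ⟨p, hpX, hpw⟩ := hXcut w hw u hu c hc huw hcw
      obtain ⟨q, hqX, hqu⟩ := hXcut u hu c hc w hw hcu huw.symm
      have hpe : s(u, w) ∉ (p.append q).edges := by
        rw [Walk.edges_append, List.mem_append]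
        rintro (he | he)
        · exact hpw (p.snd_mem_support_of_mem_edges he)
        · exact hqu (q.fst_mem_support_of_mem_edges he)
      obtain ⟨d, hd, hd1, hd2⟩ := (p.append q).exists_boundary_dart {x | G'.edist u x ≤ 10}
        (by simp) (fun hh => hfar (le_trans hh (by norm_num)))
      have hdX : d.snd ∈ X := by
        have := (p.append q).dart_snd_mem_support_of_mem_darts hd
        rw [Walk.mem_support_append_iff] at this
        exact this.elim (hpX _) (hqX _)
      have hadj : G'.Adj d.fst d.snd := by
        rw [hG', deleteEdges_adj]
        refine ⟨d.adj, fun hh => hpe ?_⟩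
        rw [← Set.mem_singleton_iff.1 hh]
        exact List.mem_map_of_mem (f := Dart.edge) hd
      have h1 : G'.edist d.fst d.snd ≤ 1 := (edist_le hadj.toWalk).trans (by simp)
      have h2 : G'.edist w d.snd ≤ 5 := (htwo _ (hnearX _ hdX)).resolve_left hd2
      rw [SimpleGraph.edist_comm] at h2
      refine hfar ((SimpleGraph.edist_triangle (v := d.snd)).trans ?_)
      refine (add_le_add ((SimpleGraph.edist_triangle (v := d.fst)).trans
        (add_le_add hd1 h1)) h2).trans (by norm_num)
    have h1 := h.le_sum_dist_of_delete hα.le hs hbuy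
      (fun t => G.dist u t + if t ∈ B then 21 else 0) (fun t => by
        by_cases ht : t ∈ B
        · simp only [ht, if_true]
          have h21 : G'.edist u t ≤ 21 := by
            rcases htwo t (hnear t ((hB t).1 ht)) with h1 | h1
            · exact h1.trans (by norm_num)
            · exact (SimpleGraph.edist_triangle (v := w)).trans
                ((add_le_add hcyc h1).trans (by norm_num))
          exact h21.trans (by exact_mod_cast Nat.le_add_left _ _)
        · simp only [ht, if_false, add_zero]
          rw [hB] at ht
          have h2 := edist_deleteEdges_le hs ht hout
          have h3 : G.dist u t = G.dist u v + G.dist v t := by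
            by_cases huv : u = v
            · subst huv; simp
            · have := dist_eq_add_of_outside hs ht (mem_outside hu huv)
              rw [G.dist_comm (u := u), this, G.dist_comm (u := t), G.dist_comm (u := v) (v := u)]
              ring
          rw [h3, Nat.cast_add]
          exact (SimpleGraph.edist_triangle (v := v)).trans (add_le_add hkeep h2))
    simp only [Nat.cast_add, Nat.cast_ite, Nat.cast_ofNat, Nat.cast_zero, Finset.sum_add_distrib,
      Finset.sum_ite_mem, Finset.univ_inter, Finset.sum_const, nsmul_eq_mul] at h1
    have h3 : (3 : ℝ) ≤ n := by exact_mod_cast hcard3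
    linarith
  -- a node of `X` farthest from `v` has two links inside `X`, one of which can be deleted
  obtain ⟨u, hu, hmax⟩ := Set.exists_max_image X (G.dist v) (Set.toFinite X) ⟨v, hv⟩
  have huv : u ≠ v := by
    rintro rfl
    obtain ⟨c, hc, hcu, -⟩ := hthird u u
    have h1 := hmax c hc
    rw [SimpleGraph.dist_self, Nat.le_zero, hs.dist_eq_zero_iff] at h1
    exact hcu h1.symm
  have hneighbour : ∀ x ∈ X, x ≠ u → ∃ y ∈ X, y ≠ x ∧ G.Adj u y := by
    intro x hx hxu
    obtain ⟨c, hc, hcu, hcx⟩ := hthird u x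
    obtain ⟨p, hpX, hpx⟩ := hXcut x hx u hu c hc hxu.symm hcx
    cases p with
    | nil => exact absurd rfl hcu
    | @cons _ y _ hadj r =>
      exact ⟨y, hpX y (by simp), fun hh => hpx (by simp [← hh]), hadj⟩
  obtain ⟨w₁, hw₁, -, ha₁⟩ := hneighbour v hv huv.symm
  obtain ⟨w₂, hw₂, hw₁₂, ha₂⟩ := hneighbour w₁ hw₁ ha₁.ne'
  have hedge : ∀ a b, ∀ p : G.Walk a v, p.length = G.dist a v → s(a, b) ∉ p.edges →
      (G.deleteEdges {s(a, b)}).edist a v ≤ G.dist a v := by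
    intro a b p hp he
    rw [← hp, ← Walk.length_transfer p (H := G.deleteEdges {s(a, b)})]
    · exact edist_le _
    · intro e hep
      rw [edgeSet_deleteEdges]
      exact ⟨p.edges_subset_edgeSet hep, fun h => he (h ▸ hep)⟩
  -- If `w` paid for the link to `u`, it could delete it: as `u` is farthest from `v`, no shortest
  -- walk from `w` to `v` visits `u`.
  have hbuy : ∀ w ∈ X, G.Adj u w → w ∈ (s u).1 := by
    intro w hw hadj
    refine hadj.resolve_right fun hwu => hdel w hw u hu hwu ?_
    obtain ⟨p, hp⟩ := hs.exists_walk_length_eq_dist w v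
    refine hedge w u p hp fun he => ?_
    obtain ⟨q, r, rfl⟩ :=
      Walk.mem_support_iff_exists_append.1 (p.snd_mem_support_of_mem_edges he)
    have h1 := hmax w hw
    have h2 := dist_le r
    have h3 : 0 < q.length := by
      rcases Nat.eq_zero_or_pos q.length with h0 | h0
      · exact absurd (Walk.eq_of_length_eq_zero h0) hadj.ne'
      · exact h0
    rw [Walk.length_append] at hp
    rw [G.dist_comm, G.dist_comm (u := v)] at h1
    omega
  obtain ⟨p, hp⟩ := hs.exists_walk_length_eq_dist u v
  have hpath := p.isPath_of_length_eq_dist hp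
  -- By `hdel`, both links would lie on the same shortest path to `v`, which uses only one edge at
  -- its start `u`.
  have honly : s(u, w₁) ∈ p.edges ∧ s(u, w₂) ∈ p.edges := by
    constructor <;> by_contra he
    · exact hdel u hu w₁ hw₁ (hbuy w₁ hw₁ ha₁) (hedge u w₁ p hp he)
    · exact hdel u hu w₂ hw₂ (hbuy w₂ hw₂ ha₂) (hedge u w₂ p hp he)
  cases p with
  | nil => exact huv rfl
  | @cons _ y _ hadj r =>
    have hur := ((Walk.cons_isPath_iff hadj r).1 hpath).2
    have hy : ∀ w, s(u, w) ∈ (Walk.cons hadj r).edges → w = y := by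
      intro w hw
      rw [Walk.edges_cons, List.mem_cons] at hw
      rcases hw with hw | hw
      · exact Sym2.congr_right.1 hw
      · exact absurd (r.fst_mem_support_of_mem_edges hw) hur
    exact hw₁₂ ((hy _ honly.2).trans (hy _ honly.1).symm)

end Nash

end NetworkCreation

/-! ### From closeness to the diameter bound. -/

theorem mainTheorem10 (n : ℕ) (α : ℝ) (hα : 0 < α)
    (hlow : ((n : ℝ) - 1) / 2 ≤ α) (hhigh : α < 4 * (n : ℝ))
    (G : SimpleGraph (Fin n)) (hG : NetworkCreation.IsNEGraph α G) (hnontree : ¬ G.IsTree)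
    (H : G.Subgraph) (hH : NetworkCreation.IsNontrivialBiconnectedComponent G H) :
    G.ediam < H.coe.ediam + 994 := by
  open NetworkCreation SimpleGraph in
  obtain ⟨s, hNE, rfl⟩ := hG
  obtain ⟨hcomp, h3⟩ := hH
  obtain ⟨hHc, hHcut⟩ := isBiconnected_coe_iff.1 hcomp.1
  obtain ⟨h₀, hh₀⟩ := hHc.nonempty
  have : Nonempty (Fin n) := ⟨h₀⟩
  have hs := hNE.connected hα.le
  have hclose : ∀ z, ∃ v ∈ H.verts, (network s).edist v z ≤ 496 := by
    intro z
    obtain ⟨v, hv, hmin⟩ := Set.exists_min_image H.verts (fun x => (network s).dist x z)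
      (Set.toFinite _) ⟨h₀, hh₀⟩
    refine ⟨v, hv, ?_⟩
    rw [← (hs.preconnected v z).coe_dist_eq_edist]
    have key := hNE.dist_le_of_nearest (X := H.verts) hα (by simpa using hlow)
      (by simpa using hhigh) hs
      (fun a ha b hb p hp x hx => hcomp.support_subset ha hb p hp hx)
      (fun w hw a ha b hb haw hbw => by
        obtain ⟨p, hp, hpw⟩ := hHcut w hw a ha b hb haw hbw
        exact ⟨p, fun x hx => hp.1 ((p.mem_verts_toSubgraph).2 hx), hpw⟩) h3 hv hmin
    exact_mod_cast key
  -- Finiteness is what makes the final inequality strict in `ℕ∞`.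
  have hfin : H.coe.ediam ≠ ⊤ := by
    have := hHc.coe.nonempty
    exact connected_iff_ediam_ne_top.1 hHc.coe
  have hle : (network s).ediam ≤ H.coe.ediam + 992 := by
    refine ediam_le_of_edist_le fun x y => ?_
    obtain ⟨a, ha, hax⟩ := hclose x
    obtain ⟨b, hb, hby⟩ := hclose y
    rw [SimpleGraph.edist_comm] at hax
    calc (network s).edist x y ≤ (network s).edist x a + (network s).edist a b +
          (network s).edist b y := (SimpleGraph.edist_triangle (v := b)).trans
            (add_le_add_left SimpleGraph.edist_triangle _)
      _ ≤ 496 + H.coe.ediam + 496 :=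
          add_le_add (add_le_add hax (edist_le_ediam_coe H ha hb)) hby
      _ = H.coe.ediam + 992 := by rw [add_comm 496, add_assoc]; norm_num
  refine hle.trans_lt ?_
  exact (ENat.add_lt_add_iff_left hfin).2 (by norm_num)
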